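/- Call $x$ an accumulation point of a sequence $(a_n)_{n\in\omega}$ in a topological space $X$ if every open $U\ni x$ contains $a_n$ for infinitely many $n$. A space $X$ is - DRC (respectively DRS) if it has a dense subset $D$ such that every sequence of points of $D$ has an accumulation point in $X$ (respectively a subsequence converging to a point of $X$); - DRC$_\omega$ (respectively DRS$_\omega$) if there are dense subsets $D_0,D_1,D_2,\dots$ of $X$ such that every sequence $(d_n)_{n\in\omega}$ with $d_n\in D_n$ for all $n$ has an accumulation point in $X$ (respectively a subsequence converging to a point of $X$). For a property $Q$ of topological spaces, a space is hereditarily $Q$ if each of its non-empty regular closed subsets (sets $F$ with $F=\overline{\operatorname{int}F}$), with the subspace topology, has property $Q$. A space is crowded if it has no isolated points, and $0$-dimensional if its clopen subsets form a base. **Theorem.** Assume the Continuum Hypothesis, $2^{\aleph_0}=\aleph_1$. Then there is a crowded, $0$-dimensional Hausdorff space $X$ of cardinality $\omega_1$ with three dense subspaces $Z_1$, $Z_2$, $Z_3$ such that 1. $Z_1$ is hereditarily (DRS$_\omega$ but not DRC); 2. $Z_2$ is hereditarily (DRS$_\omega$ and DRC, but not DRS); 3. $Z_3$ is hereditarily (DRC$_\omega$,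 but neither DRC nor DRS$_\omega$). -/

import Mathlib

open Filter Topology

universe u

/-- The set `acc a` of accumulation points of a sequence `a` in a space `X`: the points each of
whose open neighbourhoods contains `a n` for infinitely many indices `n`. -/
def acc {X : Type u} [TopologicalSpace X] (a : ℕ → X) : Set X :=
  {x | ∀ U : Set X, IsOpen U → x ∈ U → {n : ℕ | a n ∈ U}.Infinite}

/-- `acc a` consists of the cluster points of the sequence in the sense of Mathlib. -/
theorem mem_acc_iff_mapClusterPt {X : Type u} [TopologicalSpace X] {a : ℕ → X} {x : X} :
    x ∈ acc a ↔ MapClusterPt x atTop a := by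
  simp only [acc, Set.mem_ofPred_eq, (nhds_basis_opens x).mapClusterPt_iff_frequently,
    Nat.frequently_atTop_iff_infinite]
  exact ⟨fun h U hU => h U hU.2 hU.1, fun h U hU hx => h U ⟨hx, hU⟩⟩

/-- The sequence `a` has a subsequence converging to some point of the space `X`. -/
def HasConvergentSubseq {X : Type u} [TopologicalSpace X] (a : ℕ → X) : Prop :=
  ∃ (x : X) (φ : ℕ → ℕ), StrictMono φ ∧ Tendsto (a ∘ φ) atTop (𝓝 x)

/-- `S` is relatively countably compact in `X`: every sequence of points of `S` has an
accumulation point in `X`. -/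
def IsRelCountablyCompact {X : Type u} [TopologicalSpace X] (S : Set X) : Prop :=
  ∀ a : ℕ → X, (∀ n, a n ∈ S) → (acc a).Nonempty

/-- `S` is relatively sequentially compact in `X`: every sequence of points of `S` has a
subsequence converging to some point of `X`. -/
def IsRelSeqCompact {X : Type u} [TopologicalSpace X] (S : Set X) : Prop :=
  ∀ a : ℕ → X, (∀ n, a n ∈ S) → HasConvergentSubseq a

/-- DRC: `X` has a dense relatively countably compact subset. -/
def DRC (X : Type u) [TopologicalSpace X] : Prop :=
  ∃ D : Set X, Dense D ∧ IsRelCountablyCompact D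

/-- DRS: `X` has a dense relatively sequentially compact subset. -/
def DRS (X : Type u) [TopologicalSpace X] : Prop :=
  ∃ D : Set X, Dense D ∧ IsRelSeqCompact D

/-- DRC_ω: there are dense sets `D 0, D 1, …` in `X` such that every sequence `d` with
`d n ∈ D n` for all `n` has an accumulation point. -/
def DRCOmega (X : Type u) [TopologicalSpace X] : Prop :=
  ∃ D : ℕ → Set X, (∀ n, Dense (D n)) ∧
    ∀ d : ℕ → X, (∀ n, d n ∈ D n) → (acc d).Nonempty

/-- DRS_ω: there are dense sets `D 0, D 1, …` in `X` such that every sequence `d` with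
`d n ∈ D n` for all `n` has a convergent subsequence. -/
def DRSOmega (X : Type u) [TopologicalSpace X] : Prop :=
  ∃ D : ℕ → Set X, (∀ n, Dense (D n)) ∧
    ∀ d : ℕ → X, (∀ n, d n ∈ D n) → HasConvergentSubseq d

/-- `X` is hereditarily `Q`: every nonempty regular closed subset of `X`, as a subspace, has the
property `Q`. -/
def Hereditarily (Q : ∀ (Y : Type u) [TopologicalSpace Y], Prop)
    (X : Type u) [TopologicalSpace X] : Prop :=
  ∀ F : Set X, F.Nonempty → closure (interior F) = F → Q F

/-- A space is 0-dimensional if its clopen subsets form a base of the topology. -/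
def IsZeroDimensional (X : Type u) [TopologicalSpace X] : Prop :=
  TopologicalSpace.IsTopologicalBasis {U : Set X | IsClopen U}

/-! The points are the rows of an ω₁ × ω₁ matrix of zeros and ones. Each row carries a level in ℕ,
and the rows of any one level are dense in 2^ω₁. Every infinite set of rows contains an infinite set
on which the level is constant or finite-to-one, and the matrix controls these two kinds separately.
A kind can be made to contain convergent sequences (`Conv`), to accumulate without containing
convergent sequences (`Split`), or to be closed discrete (`Disc`). For (finite-to-one, constant) the
three spaces use (`Conv`, `Disc`), (`Conv`, `Split`) and (`Split`, `Disc`).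

Choosing the n-th term among the rows of level at least n gives a set of finite-to-one level, whence
the ω-properties; level 0 alone gives DRC for Z₂. Conversely, every countable set of rows vanishes
at some coordinate outside any given finite set. Hence a dense subset of a nonempty regular closed
set is uncountable and contains infinite sets of constant level, which refute DRC or DRS; for Z₃
both kinds together refute DRS_ω.

The matrix is built in ω₁ stages (`exists_matrix`). CH allows all countable sequences to be listed
(`exists_bookkeeping`), and each stage meets only countably many constraints. The convergent sets
are kept almost disjoint, so that a new column can respect all chosen limits and still split or
isolate other sets (`exists_splitting_of_almostDisjoint`). -/

/-- Definition of a function by well-founded recursion, the value at each point being chosen so as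
to satisfy a condition that depends on the earlier values. -/
theorem exists_forall_of_wellFounded {I D : Type*} [Nonempty D] {r : I → I → Prop}
    (wf : WellFounded r) (P : I → (I → D) → D → Prop)
    (hext : ∀ a f g d, (∀ b, r b a → f b = g b) → P a f d → P a g d)
    (hex : ∀ a f, (∀ b, r b a → P b f (f b)) → ∃ d, P a f d) :
    ∃ f : I → D, ∀ a, P a f (f a) := by
  classical
  let ext : (a : I) → ((b : I) → r b a → D) → I → D :=
    fun a p b => if h : r b a then p b h else Classical.arbitrary D
  let F : (a : I) → ((b : I) → r b a → D) → D :=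
    fun a p => if h : ∃ d, P a (ext a p) d then h.choose else Classical.arbitrary D
  let f : I → D := wf.fix F
  have hf : ∀ a, f a = F a (fun b _ => f b) := fun a => wf.fix_eq F a
  refine ⟨f, fun a => ?_⟩
  induction a using wf.induction with
  | _ a ih =>
    have hag : ∀ b, r b a → ext a (fun b _ => f b) b = f b := fun b hb => by simp [ext, hb]
    obtain ⟨d, hd⟩ := hex a f ih
    have h : ∃ d, P a (ext a (fun b _ => f b)) d :=
      ⟨d, hext _ _ _ _ (fun b hb => (hag b hb).symm) hd⟩
    have h2 := h.choose_spec
    have h3 : f a = h.choose := by rw [hf a]; simp only [F]; rw [dif_pos h]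
    rw [h3]
    exact hext _ _ _ _ hag h2

/-! ### Functions compatible with a countable almost disjoint family -/

/-- A sequence of infinite sets has an injective choice function. -/
theorem exists_injective_forall_mem {I : Type*} (S : ℕ → Set I) (hS : ∀ n, (S n).Infinite) :
    ∃ w : ℕ → I, Function.Injective w ∧ ∀ n, w n ∈ S n := by
  have : Nonempty I := ⟨(hS 0).nonempty.some⟩
  obtain ⟨w, hw⟩ := exists_forall_of_wellFounded (I := ℕ) (D := I) wellFounded_lt
    (fun n f d => d ∈ S n ∧ ∀ m < n, f m ≠ d)
    (fun a f g d h hd => ⟨hd.1, fun m hm => h m hm ▸ hd.2 m hm⟩)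
    (fun n f _ => by
      obtain ⟨d, hd, hd'⟩ := (hS n).exists_notMem_finite ((Set.finite_Iio n).image f)
      exact ⟨d, hd, fun m hm h => hd' ⟨m, hm, h⟩⟩)
  refine ⟨w, fun a b hab => ?_, fun n => (hw n).1⟩
  rcases lt_trichotomy a b with h | h | h
  · exact absurd hab ((hw b).2 a h)
  · exact h
  · exact absurd hab.symm ((hw a).2 b h)

theorem Set.Countable.exists_nat_injOn {I : Type*} {N : Set I} (hN : N.Countable) :
    ∃ ν : I → ℕ, Set.InjOn ν N ∧ ∀ n, {ξ ∈ N | ν ξ ≤ n}.Finite := by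
  obtain ⟨ν, hν⟩ := Set.countable_iff_exists_injOn.1 hN
  exact ⟨ν, hν, fun n => Set.Finite.of_finite_image ((Set.finite_Iic n).subset (by
    rintro _ ⟨x, hx, rfl⟩; exact hx.2)) (hν.mono fun x hx => hx.1)⟩

/-- A function prescribed on a set almost disjoint from the members of a countable almost disjoint
family `B` extends to a function whose values on `B ξ` converge to the value at `ξ`. -/
theorem exists_extension_of_almostDisjoint {I : Type*} {N : Set I} (hN : N.Countable)
    (B : I → Set I) (hB : ∀ ξ, (B ξ).Nonempty → ξ ∈ N) (hBN : ∀ ξ, B ξ ⊆ N)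
    (had : ∀ ξ η, ξ ≠ η → (B ξ ∩ B η).Finite) (T : Set I) (hT : ∀ ξ, (T ∩ B ξ).Finite)
    (g : I → Bool) :
    ∃ c : I → Bool, (∀ η ∈ T, c η = g η) ∧ ∀ ξ, {η ∈ B ξ | c η ≠ c ξ}.Finite := by
  obtain ⟨ν, hν, hfin⟩ := hN.exists_nat_injOn
  -- The trimmed sets are pairwise disjoint, omit only finitely many elements of `B ξ`, and contain
  -- only elements later than `ξ` in the enumeration `ν`. So `c η = c ξ` for `η ∈ B' ξ` is a
  -- consistent recursion along `ν`.
  let B' : I → Set I :=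
    fun ξ => {η ∈ B ξ | η ∉ T ∧ ν ξ < ν η ∧ ∀ ζ ∈ N, ν ζ < ν ξ → η ∉ B ζ}
  have hdisj : ∀ ξ ζ η, η ∈ B' ξ → η ∈ B' ζ → ξ = ζ := by
    intro ξ ζ η h1 h2
    have hξ := hB ξ ⟨η, h1.1⟩
    have hζ := hB ζ ⟨η, h2.1⟩
    rcases lt_trichotomy (ν ξ) (ν ζ) with h | h | h
    · exact absurd h1.1 (h2.2.2.2 ξ hξ h)
    · exact hν hξ hζ h
    · exact absurd h2.1 (h1.2.2.2 ζ hζ h)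
  obtain ⟨c, hc⟩ := exists_forall_of_wellFounded (I := I) (D := Bool)
    (InvImage.wf ν wellFounded_lt) (fun a f d => (∀ ξ, a ∈ B' ξ → d = f ξ) ∧ (a ∈ T → d = g a))
    (fun a f g d h hd => ⟨fun ξ hξ => (hd.1 ξ hξ).trans (h ξ hξ.2.2.1), hd.2⟩)
    (fun a f _ => by
      by_cases h : ∃ ξ, a ∈ B' ξ
      · obtain ⟨ξ, hξ⟩ := h
        exact ⟨f ξ, fun ζ hζ => by rw [hdisj _ _ _ hξ hζ], fun ha => absurd ha hξ.2.1⟩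
      · exact ⟨g a, fun ζ hζ => absurd ⟨ζ, hζ⟩ h, fun _ => rfl⟩)
  refine ⟨c, fun η hη => (hc η).2 hη, fun ξ => ?_⟩
  have h1 : (⋃ ζ ∈ {ζ ∈ N | ν ζ ≤ ν ξ} \ {ξ}, B ξ ∩ B ζ).Finite :=
    ((hfin (ν ξ)).subset Set.sdiff_subset).biUnion fun ζ hζ => had ξ ζ (Ne.symm hζ.2)
  refine (((hT ξ).union (hfin (ν ξ))).union h1).subset ?_
  rintro η ⟨hη, hne⟩
  by_contra hcon
  simp only [Set.mem_union, not_or] at hcon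
  refine hne ((hc η).1 ξ ⟨hη, fun h => hcon.1.1 ⟨h, hη⟩, ?_, ?_⟩)
  · by_contra h
    exact hcon.1.2 ⟨hBN ξ hη, not_lt.1 h⟩
  · intro ζ hζ hlt hηζ
    refine hcon.2 (Set.mem_biUnion (x := ζ) ⟨⟨hζ, hlt.le⟩, ?_⟩ ⟨hη, hηζ⟩)
    rintro rfl
    exact lt_irrefl _ hlt

/-- As in `exists_extension_of_almostDisjoint`, with a function that also splits countably many
infinite sets almost disjoint from the family `B`, and isolates a point `e` from a set `C`. -/
theorem exists_splitting_of_almostDisjoint {I : Type*} {N : Set I} (hN : N.Countable)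
    (B : I → Set I) (hB : ∀ ξ, (B ξ).Nonempty → ξ ∈ N) (hBN : ∀ ξ, B ξ ⊆ N)
    (had : ∀ ξ η, ξ ≠ η → (B ξ ∩ B η).Finite) (𝓢 : Set (Set I)) (h𝓢 : 𝓢.Countable)
    (hinf : ∀ S ∈ 𝓢, S.Infinite) (hSB : ∀ S ∈ 𝓢, ∀ ξ, (S ∩ B ξ).Finite)
    (C : Set I) (hCB : ∀ ξ, (C ∩ B ξ).Finite) (hCS : ∀ S ∈ 𝓢, (C ∩ S).Finite) (e : I) :
    ∃ c : I → Bool, (∀ ξ, {η ∈ B ξ | c η ≠ c ξ}.Finite) ∧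
      (∀ S ∈ 𝓢, ∀ v, {η ∈ S | c η = v}.Infinite) ∧ c e = true ∧
      ∀ η ∈ C, η ≠ e → c η = false := by
  classical
  obtain ⟨ν, hν, hfin⟩ := hN.exists_nat_injOn
  have hT0 : ∀ ξ, ((C ∪ {e}) ∩ B ξ).Finite := fun ξ => by
    rw [Set.union_inter_distrib_right]
    exact (hCB ξ).union ((Set.finite_singleton e).subset Set.inter_subset_left)
  rcases 𝓢.eq_empty_or_nonempty with rfl | hne
  · obtain ⟨c, hc1, hc2⟩ := exists_extension_of_almostDisjoint hN B hB hBN had (C ∪ {e}) hT0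
      (fun η => decide (η = e))
    exact ⟨c, hc2, by simp, by simp [hc1 e], fun η hη hηe => by simp [hc1 η (Or.inl hη), hηe]⟩
  obtain ⟨s, hs⟩ := h𝓢.exists_eq_range hne
  have hs' : ∀ i, s i ∈ 𝓢 := fun i => hs ▸ Set.mem_range_self i
  -- A triple consists of the set to be split, a repetition counter and the value to be taken.
  obtain ⟨q⟩ : Nonempty (ℕ ≃ ℕ × ℕ × Bool) := nonempty_equiv_of_countable
  -- Since `w n` avoids `B ξ` whenever `ν ξ ≤ n`, each `B ξ` contains only finitely many `w n`, and
  -- values may be prescribed on the range of `w`.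
  obtain ⟨w, hwi, hw⟩ := exists_injective_forall_mem
    (fun n => s (q n).1 \ ((C ∪ {e}) ∩ s (q n).1 ∪ ⋃ ξ ∈ {ξ ∈ N | ν ξ ≤ n}, s (q n).1 ∩ B ξ))
    (fun n => (hinf _ (hs' _)).sdiff (Set.Finite.union (by
      rw [Set.union_inter_distrib_right]
      exact (hCS _ (hs' _)).union ((Set.finite_singleton e).subset Set.inter_subset_left))
      ((hfin n).biUnion fun ξ _ => hSB _ (hs' _) ξ)))
  have hwT : ∀ n, w n ∉ C ∪ {e} := fun n h => (hw n).2 (Or.inl ⟨h, (hw n).1⟩)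
  have hT : ∀ ξ, ((C ∪ {e} ∪ Set.range w) ∩ B ξ).Finite := by
    intro ξ
    rw [Set.union_inter_distrib_right]
    refine (hT0 ξ).union (((Set.finite_Iio (ν ξ)).image w).subset ?_)
    rintro _ ⟨⟨n, rfl⟩, hn⟩
    refine ⟨n, ?_, rfl⟩
    by_contra h
    exact (hw n).2 (Or.inr (Set.mem_biUnion (x := ξ) ⟨hB ξ ⟨_, hn⟩, not_lt.1 h⟩ ⟨(hw n).1, hn⟩))
  obtain ⟨c, hc1, hc2⟩ := exists_extension_of_almostDisjoint hN B hB hBN had _ hT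
    (fun η => if η ∈ C ∪ {e} then decide (η = e) else decide (∃ n, w n = η ∧ (q n).2.2 = true))
  refine ⟨c, hc2, ?_, ?_, ?_⟩
  · intro S hS v
    rw [hs] at hS
    obtain ⟨i, rfl⟩ := hS
    have hinj : Function.Injective fun m : ℕ => w (q.symm (i, m, v)) := by
      intro m m' h
      simpa using q.symm.injective (hwi h)
    refine (Set.infinite_range_of_injective hinj).mono ?_
    rintro _ ⟨m, rfl⟩
    have h1 := (hw (q.symm (i, m, v))).1
    simp only [Equiv.apply_symm_apply] at h1
    refine ⟨h1, ?_⟩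
    rw [hc1 _ (Or.inr ⟨_, rfl⟩), if_neg (hwT _)]
    have : (∃ n, w n = w (q.symm (i, m, v)) ∧ (q n).2.2 = true) ↔ v = true := by
      constructor
      · rintro ⟨n, hn, h⟩
        rw [hwi hn] at h
        simpa using h
      · rintro rfl
        exact ⟨_, rfl, by simp⟩
    cases v <;> simp [this]
  · rw [hc1 e (Or.inl (Or.inr rfl))]; simp
  · intro η hη hne
    rw [hc1 η (Or.inl (Or.inl hη))]; simp [hne, hη]

/-- Sequential compactness of `2^κ` for countable `κ`, for families of functions on a set. -/
theorem exists_infinite_subset_eventuallyConst {I κ : Type*} [Countable κ] (φ : κ → I → Bool)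
    {A : Set I} (hA : A.Infinite) :
    ∃ (B : Set I) (p : κ → Bool), B ⊆ A ∧ B.Infinite ∧ ∀ k, {η ∈ B | φ k η ≠ p k}.Finite := by
  let a := hA.natEmbedding
  obtain ⟨p, ψ, hψ, hlim⟩ := CompactSpace.tendsto_subseq (fun n k => φ k (a n) : ℕ → κ → Bool)
  have hinj : Function.Injective fun n => (a (ψ n) : I) :=
    Subtype.val_injective.comp (a.injective.comp hψ.injective)
  refine ⟨Set.range fun n => (a (ψ n) : I), p, ?_, Set.infinite_range_of_injective hinj, ?_⟩
  · rintro _ ⟨n, rfl⟩; exact (a (ψ n)).2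
  · intro k
    have h := (tendsto_pi_nhds.1 hlim k).eventually_mem (show {p k} ∈ 𝓝 (p k) by simp)
    obtain ⟨m, hm⟩ := eventually_atTop.1 h
    refine ((Set.finite_Iio m).image fun n => (a (ψ n) : I)).subset ?_
    rintro _ ⟨⟨n, rfl⟩, hn⟩
    refine ⟨n, ?_, rfl⟩
    by_contra h
    exact hn (by simpa using hm n (not_lt.1 h))

/-! ### The transfinite construction of the matrix -/

/-- The data chosen at a stage `α` of the construction: the values at coordinates `β ≤ α` of the
point with index `α`, the values at the coordinate `α` of the points with index `η < α`, and a set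
of earlier points that is to accumulate at the point with index `α`. -/
structure Stage (I : Type u) where
  B : Set I
  row : I → Bool
  col : I → Bool

instance (I : Type u) : Nonempty (Stage I) := ⟨⟨∅, fun _ => false, fun _ => false⟩⟩

/-- The coordinate `β` of the point with index `η`. -/
def Stage.val {I : Type u} [LinearOrder I] (f : I → Stage I) (η β : I) : Bool :=
  if β ≤ η then (f η).row β else (f β).col η

/-- What is to be arranged at a stage: a mode, a sequence of points, a point, and a finite set of
coordinates. In mode 0 the new point is the indicator of the finite set, in mode 1 the new
coordinate vanishes on all earlier points, in mode 2 the new point is an accumulation point of the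
sequence, in mode 3 the new coordinate splits the sequence, and in mode 4 it isolates the point
from the sequence. -/
abbrev StageTask (I : Type u) := Fin 5 × (ℕ → I) × I × Finset I

/-- The requirements on the coordinate with index `α`. -/
structure ColumnOK {I : Type u} [LinearOrder I] (Conv Split Disc : Set I → Prop) (t : StageTask I)
    (α : I) (f : I → Stage I) (col : I → Bool) : Prop where
  conv : ∀ ξ < α, Conv (f ξ).B → {η ∈ (f ξ).B | col η ≠ col ξ}.Finite
  -- `T` codes a 0-1 pattern on `F`. The condition carries accumulation at `ξ` over to one more
  -- coordinate.
  acc : ∀ ξ < α, Split (f ξ).B → ∀ F T : Finset I, (∀ β ∈ F, β < α) →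
    {η ∈ (f ξ).B | ∀ β ∈ F, Stage.val f η β = decide (β ∈ T)}.Infinite →
    {η ∈ (f ξ).B | (∀ β ∈ F, Stage.val f η β = decide (β ∈ T)) ∧ col η = col ξ}.Infinite
  zero : t.1 = 1 → ∀ η, col η = false
  split : t.1 = 3 → Split (Set.range t.2.1) → (Set.range t.2.1).Infinite →
    (∀ n, t.2.1 n < α) → ∀ v, {η ∈ Set.range t.2.1 | col η = v}.Infinite
  isolate : t.1 = 4 → Disc (Set.range t.2.1) → (∀ n, t.2.1 n < α) →
    col t.2.2.1 = true ∧ ∀ η ∈ Set.range t.2.1, η ≠ t.2.2.1 → col η = false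

/-- The requirements on the point with index `α`. -/
structure PointOK {I : Type u} [LinearOrder I] (Conv Split : Set I → Prop) (t : StageTask I)
    (α : I) (f : I → Stage I) (d : Stage I) : Prop where
  lt : ∀ η ∈ d.B, η < α
  lim : ∀ β < α, {η ∈ d.B | Stage.val f η β ≠ d.row β}.Finite
  lim_self : {η ∈ d.B | d.col η ≠ d.row α}.Finite
  disj : Conv d.B → ∀ ξ < α, Conv (f ξ).B → (d.B ∩ (f ξ).B).Finite
  finset : t.1 = 0 → ∀ β, d.row β = decide (β ∈ t.2.2.2)
  conv : t.1 = 2 → Conv (Set.range t.2.1) → (Set.range t.2.1).Infinite → (∀ n, t.2.1 n < α) →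
    (Conv d.B ∧ (d.B ∩ Set.range t.2.1).Infinite) ∨
      ∃ ξ < α, Conv (f ξ).B ∧ ((f ξ).B ∩ Set.range t.2.1).Infinite
  acc : t.1 = 2 → Split (Set.range t.2.1) → (Set.range t.2.1).Infinite → (∀ n, t.2.1 n < α) →
    d.B ⊆ Set.range t.2.1 ∧ d.B.Infinite

section

variable {I : Type u} [LinearOrder I] {Conv Split Disc : Set I → Prop}

theorem Stage.val_congr {α : I} {f g : I → Stage I} (h : ∀ β < α, f β = g β) {η β : I}
    (hη : η < α) (hβ : β < α) : Stage.val f η β = Stage.val g η β := by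
  simp only [Stage.val, h η hη, h β hβ]

theorem ColumnOK.congr {t : StageTask I} {α : I} {f g : I → Stage I} {col : I → Bool}
    (hB : ∀ ξ < α, ∀ η ∈ (f ξ).B, η < ξ) (h : ∀ β < α, f β = g β)
    (hf : ColumnOK Conv Split Disc t α f col) : ColumnOK Conv Split Disc t α g col where
  conv ξ hξ := h ξ hξ ▸ hf.conv ξ hξ
  acc ξ hξ hS F T hF := by
    have key : ∀ η ∈ (g ξ).B, ((∀ β ∈ F, Stage.val g η β = decide (β ∈ T)) ↔
        ∀ β ∈ F, Stage.val f η β = decide (β ∈ T)) := fun η hη =>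
      forall₂_congr fun β hβ => by
        rw [Stage.val_congr h ((hB ξ hξ η (h ξ hξ ▸ hη)).trans hξ) (hF β hβ)]
    have h1 := hf.acc ξ hξ (h ξ hξ ▸ hS) F T hF
    rw [h ξ hξ] at h1
    intro h2
    refine (h1 (h2.mono fun η hη => ⟨hη.1, (key η hη.1).1 hη.2⟩)).mono
      fun η hη => ⟨hη.1, (key η hη.1).2 hη.2.1, hη.2.2⟩
  zero := hf.zero
  split := hf.split
  isolate := hf.isolate

theorem PointOK.congr {t : StageTask I} {α : I} {f g : I → Stage I} {d : Stage I}
    (h : ∀ β < α, f β = g β) (hf : PointOK Conv Split t α f d) : PointOK Conv Split t α g d where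
  lt := hf.lt
  lim β hβ := (hf.lim β hβ).subset fun η hη =>
    ⟨hη.1, by rw [Stage.val_congr h (hf.lt η hη.1) hβ]; exact hη.2⟩
  lim_self := hf.lim_self
  disj hc ξ hξ := h ξ hξ ▸ hf.disj hc ξ hξ
  finset := hf.finset
  conv h1 h2 h3 h4 := (hf.conv h1 h2 h3 h4).imp_right fun ⟨ξ, hξ, h5⟩ => ⟨ξ, hξ, h ξ hξ ▸ h5⟩
  acc := hf.acc

/-- The earlier `Conv` sets form a countable almost disjoint family, and the sets to be split or
isolated are almost disjoint from it. Splitting every infinite pattern set of a `Split` set makes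
both values occur infinitely often there, in particular the value at `ξ`. -/
theorem exists_columnOK (hI : ∀ α : I, (Set.Iio α).Countable)
    (hSplit : ∀ A B, A ⊆ B → Split B → Split A)
    (hCS : ∀ A B, Conv A → Split B → (A ∩ B).Finite)
    (hCD : ∀ A B, Conv A → Disc B → (A ∩ B).Finite)
    (hSD : ∀ A B, Split A → Disc B → (A ∩ B).Finite) (t : StageTask I) (α : I) (f : I → Stage I)
    (hlt : ∀ ξ < α, ∀ η ∈ (f ξ).B, η < ξ)
    (had : ∀ ξ < α, Conv (f ξ).B → ∀ ζ < ξ, Conv (f ζ).B → ((f ξ).B ∩ (f ζ).B).Finite) :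
    ∃ col, ColumnOK Conv Split Disc t α f col := by
  classical
  -- A constant column preserves every limit and every accumulation.
  by_cases h1 : t.1 = 1
  · refine ⟨fun _ => false, ⟨fun ξ _ _ => by simp, fun ξ _ _ F T _ h => by simpa using h,
      fun _ _ => rfl, fun h => ?_, fun h => ?_⟩⟩ <;> exact absurd (h1 ▸ h) (by decide)
  -- Sets that are not earlier `Conv` sets are replaced by the empty set.
  let B : I → Set I := fun ξ => {η | ξ < α ∧ Conv (f ξ).B ∧ η ∈ (f ξ).B}
  have hBsub : ∀ ξ, B ξ ⊆ (f ξ).B := fun ξ η hη => hη.2.2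
  have hBC : ∀ ξ S, (Conv (f ξ).B → (S ∩ (f ξ).B).Finite) → (S ∩ B ξ).Finite := by
    intro ξ S h
    by_cases hc : Conv (f ξ).B
    · exact (h hc).subset (Set.inter_subset_inter_right _ (hBsub ξ))
    · convert Set.finite_empty
      ext η
      exact ⟨fun hη => (hc hη.2.2.1).elim, fun hη => hη.elim⟩
  let S : Set.Iio α × Finset (Set.Iio α) × Finset (Set.Iio α) → Set I := fun x =>
    {η ∈ (f x.1).B | ∀ β ∈ x.2.1, Stage.val f η β = decide (β ∈ x.2.2)}
  have : Countable (Set.Iio α) := (hI α).to_subtype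
  let C : Set I := {η | t.1 = 4 ∧ Disc (Set.range t.2.1) ∧ η ∈ Set.range t.2.1}
  have hC : ∀ D : Set I, (Disc (Set.range t.2.1) → (D ∩ Set.range t.2.1).Finite) →
      (C ∩ D).Finite := by
    intro D h
    by_cases hc : Disc (Set.range t.2.1)
    · exact (h hc).subset fun η hη => ⟨hη.2, hη.1.2.2⟩
    · convert Set.finite_empty
      ext η
      exact ⟨fun hη => (hc hη.1.2.1).elim, fun hη => hη.elim⟩
  let 𝓢 : Set (Set I) := {A | A.Infinite ∧ Split A ∧ (A = Set.range t.2.1 ∨ A ∈ Set.range S)}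
  obtain ⟨c, hc1, hc2, hc3, hc4⟩ := exists_splitting_of_almostDisjoint (hI α) B
    (fun ξ ⟨η, hη⟩ => hη.1) (fun ξ η hη => (hlt ξ hη.1 η hη.2.2).trans hη.1)
    (by
      have key : ∀ ξ ζ, ζ < ξ → (B ξ ∩ B ζ).Finite := by
        intro ξ ζ h
        by_cases hne : (B ξ ∩ B ζ).Nonempty
        · obtain ⟨η, hη, hη'⟩ := hne
          exact (had ξ hη.1 hη.2.1 ζ h hη'.2.1).subset
            (Set.inter_subset_inter (hBsub ξ) (hBsub ζ))
        · rw [Set.not_nonempty_iff_eq_empty.1 hne]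
          exact Set.finite_empty
      intro ξ ζ hne
      rcases lt_or_gt_of_ne hne with h | h
      · rw [Set.inter_comm]; exact key _ _ h
      · exact key _ _ h)
    𝓢 (((Set.countable_singleton (Set.range t.2.1)).union (Set.countable_range S)).mono
      fun A hA => hA.2.2) (fun A hA => hA.1)
    (fun A hA ξ => hBC ξ A fun h => Set.inter_comm _ _ ▸ hCS _ _ h hA.2.1)
    C (fun ξ => hBC ξ C fun h => hC _ fun h' => hCD _ _ h h')
    (fun A hA => hC _ fun h => hSD _ _ hA.2.1 h) t.2.2.1
  refine ⟨c, ⟨?_, ?_, fun h => absurd h h1, ?_, ?_⟩⟩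
  · exact fun ξ hξ h => (hc1 ξ).subset fun η hη => ⟨⟨hξ, h, hη.1⟩, hη.2⟩
  · intro ξ hξ hs F T hF hinf
    have hS : S (⟨ξ, hξ⟩, F.subtype (· ∈ Set.Iio α), T.subtype (· ∈ Set.Iio α)) =
        {η ∈ (f ξ).B | ∀ β ∈ F, Stage.val f η β = decide (β ∈ T)} := by
      ext η
      simp only [S, Set.mem_ofPred_eq, Finset.mem_subtype, Subtype.forall]
      exact and_congr_right fun _ => ⟨fun h β hβ => h β (hF β hβ) hβ, fun h β _ hβ => h β hβ⟩
    exact (hc2 _ ⟨hinf, hSplit _ _ (fun η hη => hη.1) hs, Or.inr ⟨_, hS⟩⟩ (c ξ)).mono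
      fun η hη => ⟨hη.1.1, hη.1.2, hη.2⟩
  · exact fun _ hs hinf _ v => hc2 _ ⟨hinf, hs, Or.inl rfl⟩ v
  · exact fun h hd _ => ⟨hc3, fun η hη => hc4 η ⟨h, hd, hη⟩⟩

/-- Only countably many coordinates are at most `α`, so a sequence has an infinite subset on which
all of them converge; the limit is the new row. If an earlier `Conv` set already meets a `Conv`
sequence in an infinite set, nothing is added, which keeps the family almost disjoint. -/
theorem exists_pointOK (hI : ∀ α : I, (Set.Iio α).Countable)
    (hConv : ∀ A B, A ⊆ B → Conv B → Conv A)
    (hCS : ∀ A B, Conv A → Split B → (A ∩ B).Finite)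
    (t : StageTask I) (α : I) (f : I → Stage I) (col : I → Bool) :
    ∃ d, d.col = col ∧ PointOK Conv Split t α f d := by
  classical
  by_cases h2 : t.1 = 2
  swap
  · refine ⟨⟨∅, fun β => decide (β ∈ t.2.2.2), col⟩, rfl, ?_, ?_, ?_, ?_, fun _ _ => rfl, ?_, ?_⟩
    all_goals first | exact fun h => absurd h h2 | simp
  have h0 : t.1 ≠ 0 := by rw [h2]; decide
  by_cases hA : (Set.range t.2.1).Infinite ∧ (∀ n, t.2.1 n < α) ∧
    ¬ ∃ ξ < α, Conv (Set.range t.2.1) ∧ Conv (f ξ).B ∧ ((f ξ).B ∩ Set.range t.2.1).Infinite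
  · obtain ⟨hinf, hltα, hno⟩ := hA
    have : Countable (Set.Iio α) := (hI α).to_subtype
    have : Countable (Set.Iic α) := by
      rw [← Set.Iio_insert]
      exact ((hI α).insert α).to_subtype
    obtain ⟨B, p, hBA, hB, hp⟩ := exists_infinite_subset_eventuallyConst
      (fun (k : Set.Iic α) η => if (k : I) < α then Stage.val f η k else col η) hinf
    by_cases hgood : Conv (Set.range t.2.1) ∨ Split (Set.range t.2.1)
    swap
    · refine ⟨⟨∅, fun _ => false, col⟩, rfl, ?_, ?_, ?_, ?_, fun h => absurd h h0,
        fun _ h => absurd (Or.inl h) hgood, fun _ h => absurd (Or.inr h) hgood⟩ <;> simp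
    refine ⟨⟨B, fun β => if h : β ≤ α then p ⟨β, h⟩ else false, col⟩, rfl, ?_, ?_, ?_, ?_,
      fun h => absurd h h0, ?_, ?_⟩
    · intro η hη
      obtain ⟨n, rfl⟩ := hBA hη
      exact hltα n
    · intro β hβ
      simpa [hβ, hβ.le] using hp ⟨β, hβ.le⟩
    · simpa using hp ⟨α, le_rfl⟩
    · intro hc ξ hξ hξc
      rcases hgood with h | h
      · by_contra hcon
        exact hno ⟨ξ, hξ, h, hξc, Set.Infinite.mono (fun η hη => ⟨hη.2, hBA hη.1⟩) hcon⟩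
      · have := hCS _ _ hc h
        rw [Set.inter_eq_left.2 hBA] at this
        exact absurd this hB
    · intro _ h _ _
      exact Or.inl ⟨hConv _ _ hBA h, by rwa [Set.inter_eq_left.2 hBA]⟩
    · exact fun _ _ _ _ => ⟨hBA, hB⟩
  · refine ⟨⟨∅, fun _ => false, col⟩, rfl, ?_, ?_, ?_, ?_, fun h => absurd h h0, ?_, ?_⟩
    · simp
    · simp
    · simp
    · simp
    · intro _ hc hinf hlt
      by_contra hcon
      refine hA ⟨hinf, hlt, ?_⟩
      rintro ⟨ξ, hξ, -, h⟩
      exact hcon (Or.inr ⟨ξ, hξ, h⟩)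
    · intro _ hs hinf hlt
      by_contra
      refine hA ⟨hinf, hlt, ?_⟩
      rintro ⟨ξ, hξ, hc, -⟩
      have := hCS _ _ hc hs
      rw [Set.inter_self] at this
      exact hinf this

/-- The matrix of points and coordinates. Sets in `Conv` contain sequences converging to one of
the points, sets in `Split` accumulate at one of the points but contain no convergent sequences,
and sets in `Disc` are closed discrete. -/
theorem exists_matrix [WellFoundedLT I] (hI : ∀ α : I, (Set.Iio α).Countable)
    (hbdd : ∀ D : Set I, D.Countable → ∃ a, ∀ ξ ∈ D, ξ < a)
    (hConv : ∀ A B, A ⊆ B → Conv B → Conv A) (hSplit : ∀ A B, A ⊆ B → Split B → Split A)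
    (hCS : ∀ A B, Conv A → Split B → (A ∩ B).Finite)
    (hCD : ∀ A B, Conv A → Disc B → (A ∩ B).Finite)
    (hSD : ∀ A B, Split A → Disc B → (A ∩ B).Finite)
    (lev : I → ℕ) (task : I → StageTask I)
    (htask : ∀ n t a, ∃ α, a < α ∧ lev α = n ∧ task α = t) :
    ∃ z : I → I → Bool,
      (∀ n (F : Finset I) (x : I → Bool), ∃ ξ, lev ξ = n ∧ ∀ β ∈ F, z ξ β = x β) ∧
      (∀ D : Set I, D.Countable → ∀ F : Finset I, ∃ β, β ∉ F ∧ ∀ ξ ∈ D, z ξ β = false) ∧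
      (∀ A : Set I, A.Countable → A.Infinite → Conv A →
        ∃ ξ, ∃ B ⊆ A, B.Infinite ∧ ∀ β, {η ∈ B | z η β ≠ z ξ β}.Finite) ∧
      (∀ A : Set I, A.Countable → A.Infinite → Split A →
        ∃ ξ, ∀ F : Finset I, {η ∈ A | ∀ β ∈ F, z η β = z ξ β}.Infinite) ∧
      (∀ A : Set I, A.Countable → A.Infinite → Split A →
        ∃ β, ∀ v, {η ∈ A | z η β = v}.Infinite) ∧
      (∀ A : Set I, A.Countable → A.Infinite → Disc A → ∀ e,
        ∃ β, z e β = true ∧ ∀ η ∈ A, η ≠ e → z η β = false) := by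
  classical
  obtain ⟨f, hf⟩ := exists_forall_of_wellFounded (I := I) (D := Stage I) wellFounded_lt
    (fun α f d => (∀ ξ < α, ∀ η ∈ (f ξ).B, η < ξ) ∧ ColumnOK Conv Split Disc (task α) α f d.col ∧
      PointOK Conv Split (task α) α f d)
    (fun α f g d h hd => ⟨fun ξ hξ => h ξ hξ ▸ hd.1 ξ hξ, hd.2.1.congr hd.1 h, hd.2.2.congr h⟩)
    (fun α f ih => by
      have hlt : ∀ ξ < α, ∀ η ∈ (f ξ).B, η < ξ := fun ξ hξ => (ih ξ hξ).2.2.lt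
      obtain ⟨col, hcol⟩ := exists_columnOK hI hSplit hCS hCD hSD (task α) α f hlt
        fun ξ hξ => (ih ξ hξ).2.2.disj
      obtain ⟨d, rfl, hd⟩ := exists_pointOK hI hConv hCS (task α) α f col
      exact ⟨d, hlt, hcol, hd⟩)
  have hcol := fun α => (hf α).2.1
  have hpt := fun α => (hf α).2.2
  have hval : ∀ {η β}, η < β → Stage.val f η β = (f β).col η := fun h => if_neg (not_le.2 h)
  have hval' : ∀ {η β}, β ≤ η → Stage.val f η β = (f η).row β := fun h => if_pos h
  have hlim : ∀ ξ, ∀ β ≤ ξ, {η ∈ (f ξ).B | Stage.val f η β ≠ Stage.val f ξ β}.Finite := by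
    intro ξ β hβ
    rw [hval' hβ]
    rcases hβ.lt_or_eq with h | rfl
    · exact (hpt ξ).lim β h
    · exact (hpt β).lim_self.subset fun η hη => ⟨hη.1, by
        rw [← hval ((hpt β).lt η hη.1)]; exact hη.2⟩
  have hconv : ∀ ξ, Conv (f ξ).B → ∀ β,
      {η ∈ (f ξ).B | Stage.val f η β ≠ Stage.val f ξ β}.Finite := by
    intro ξ hc β
    rcases le_or_gt β ξ with h | h
    · exact hlim ξ β h
    · refine ((hcol β).conv ξ h hc).subset fun η hη => ⟨hη.1, ?_⟩
      rw [← hval h, ← hval (((hpt ξ).lt η hη.1).trans h)]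
      exact hη.2
  have henum : ∀ A : Set I, A.Countable → A.Infinite → ∃ a : ℕ → I, A = Set.range a :=
    fun A h h' => h.exists_eq_range h'.nonempty
  have hpick : ∀ (m : Fin 5) (a : ℕ → I) (e : I) (s : Finset I) (b : I), ∃ α, b < α ∧ e < α ∧
      (∀ n, a n < α) ∧ task α = (m, a, e, s) := by
    intro m a e s b
    obtain ⟨c, hc⟩ := hbdd _ (((Set.countable_range a).insert e).insert b)
    obtain ⟨α, hα, -, ht⟩ := htask 0 (m, a, e, s) c
    exact ⟨α, (hc b (by simp)).trans hα, (hc e (by simp)).trans hα,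
      fun n => (hc _ (by simp)).trans hα, ht⟩
  obtain ⟨a₀, -⟩ := hbdd ∅ Set.countable_empty
  refine ⟨Stage.val f, ?_, ?_, ?_, ?_, ?_, ?_⟩
  · intro n F x
    obtain ⟨b, hb⟩ := hbdd _ F.countable_toSet
    obtain ⟨α, hα, hn, ht⟩ := htask n (0, fun _ => a₀, a₀, F.filter fun β => x β = true) b
    refine ⟨α, hn, fun β hβ => ?_⟩
    rw [hval' ((hb β hβ).trans hα).le, (hpt α).finset (by rw [ht]) β, ht]
    simp [hβ]
  · intro D hD F
    obtain ⟨c, hc⟩ := hbdd _ (hD.union F.countable_toSet)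
    obtain ⟨α, hα, -, ht⟩ := htask 0 (1, fun _ => a₀, a₀, ∅) c
    refine ⟨α, fun hF => (hc α (Or.inr hF)).not_gt hα, fun ξ hξ => ?_⟩
    rw [hval ((hc ξ (Or.inl hξ)).trans hα)]
    exact (hcol α).zero (by rw [ht]) ξ
  · intro A hA hinf hc
    obtain ⟨a, rfl⟩ := henum A hA hinf
    obtain ⟨α, -, -, hlt, ht⟩ := hpick 2 a a₀ ∅ a₀
    have key : ∃ ξ, Conv (f ξ).B ∧ ((f ξ).B ∩ Set.range a).Infinite := by
      have := (hpt α).conv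
      rw [ht] at this
      rcases this rfl hc hinf hlt with h | ⟨ξ, -, h⟩
      exacts [⟨α, h⟩, ⟨ξ, h⟩]
    obtain ⟨ξ, h1, h2⟩ := key
    exact ⟨ξ, _, Set.inter_subset_right, h2, fun β =>
      (hconv ξ h1 β).subset fun η hη => ⟨hη.1.1, hη.2⟩⟩
  · intro A hA hinf hs
    obtain ⟨a, rfl⟩ := henum A hA hinf
    obtain ⟨α, -, -, hlt, ht⟩ := hpick 2 a a₀ ∅ a₀
    have key := (hpt α).acc
    rw [ht] at key
    obtain ⟨hsub, hB⟩ := key rfl hs hinf hlt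
    refine ⟨α, fun F => ?_⟩
    suffices h : {η ∈ (f α).B | ∀ β ∈ F, Stage.val f η β = Stage.val f α β}.Infinite from
      h.mono fun η hη => ⟨hsub hη.1, hη.2⟩
    -- Coordinates are added in increasing order because `ColumnOK.acc` at `β` concerns patterns on
    -- coordinates below `β`. For `β ≤ α` convergence on `(f α).B` suffices: only finitely many
    -- elements are lost.
    induction F using Finset.induction_on_max with
    | empty => simpa using hB
    | insert β F hF ih =>
      rcases le_or_gt β α with h | h
      · refine (ih.sdiff (hlim α β h)).mono fun η hη => ⟨hη.1.1, fun γ hγ => ?_⟩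
        rcases Finset.mem_insert.1 hγ with rfl | hγ
        · by_contra hne
          exact hη.2 ⟨hη.1.1, hne⟩
        · exact hη.1.2 γ hγ
      · have hT : ∀ γ ∈ F, decide (γ ∈ F.filter fun γ => Stage.val f α γ = true) =
            Stage.val f α γ := fun γ hγ => by simp [hγ]
        refine ((hcol β).acc α h (hSplit _ _ hsub hs) F
          (F.filter fun γ => Stage.val f α γ = true) hF (ih.mono fun η hη =>
            ⟨hη.1, fun γ hγ => (hη.2 γ hγ).trans (hT γ hγ).symm⟩)).mono
          fun η hη => ⟨hη.1, fun γ hγ => ?_⟩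
        rcases Finset.mem_insert.1 hγ with rfl | hγ
        · rw [hval h, hval (((hpt α).lt η hη.1).trans h)]
          exact hη.2.2
        · exact (hη.2.1 γ hγ).trans (hT γ hγ)
  · intro A hA hinf hs
    obtain ⟨a, rfl⟩ := henum A hA hinf
    obtain ⟨α, -, -, hlt, ht⟩ := hpick 3 a a₀ ∅ a₀
    have key := (hcol α).split
    rw [ht] at key
    refine ⟨α, fun v => (key rfl hs hinf hlt v).mono ?_⟩
    rintro _ ⟨⟨n, rfl⟩, hη⟩
    exact ⟨⟨n, rfl⟩, (hval (hlt n)).trans hη⟩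
  · intro A hA hinf hd e
    obtain ⟨a, rfl⟩ := henum A hA hinf
    obtain ⟨α, -, he, hlt, ht⟩ := hpick 4 a e ∅ a₀
    have key := (hcol α).isolate
    rw [ht] at key
    obtain ⟨h1, h2⟩ := key rfl hd hlt
    refine ⟨α, (hval he).trans h1, ?_⟩
    rintro _ ⟨n, rfl⟩ hne
    exact (hval (hlt n)).trans (h2 _ ⟨n, rfl⟩ hne)

end

open Cardinal in
/-- Under the Continuum Hypothesis all tasks can be listed, each of them unboundedly often, in
order type `ω₁`. -/
theorem exists_bookkeeping (CH : Cardinal.continuum.{0} = Cardinal.aleph.{0} 1) :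
    ∃ (I : Type) (_ : LinearOrder I) (_ : WellFoundedLT I), #I = ℵ_ 1 ∧
      (∀ α : I, (Set.Iio α).Countable) ∧
      (∀ D : Set I, D.Countable → ∃ a, ∀ ξ ∈ D, ξ < a) ∧
      ∃ (lev : I → ℕ) (task : I → StageTask I),
        ∀ n t a, ∃ α, a < α ∧ lev α = n ∧ task α = t := by
  let I := (Cardinal.aleph.{0} 1).ord.ToType
  have hI : #I = ℵ_ 1 := Cardinal.mk_ord_toType _
  have hc : ∀ α : I, (Set.Iio α).Countable := fun α => by
    rw [← Cardinal.le_aleph0_iff_set_countable, ← Order.lt_succ_iff, Cardinal.succ_aleph0]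
    exact (Cardinal.mk_Iio_lt α (by rw [hI, Ordinal.type_toType])).trans_eq hI
  have hc' : ∀ α : I, (Set.Iic α).Countable := fun α => by
    rw [← Set.Iio_insert]; exact (hc α).insert α
  have hunc : ¬ (Set.univ : Set I).Countable := fun h => by
    rw [← Cardinal.le_aleph0_iff_set_countable, Cardinal.mk_univ, hI] at h
    exact h.not_gt Cardinal.aleph0_lt_aleph_one
  have hinf : Infinite I := Cardinal.aleph0_le_mk_iff.1 (hI ▸ Cardinal.aleph0_le_aleph 1)
  -- CH enters here, through ℵ₁ ^ ℵ₀ = ℵ₁. The extra factor `I` repeats each task ℵ₁ times, hence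
  -- unboundedly, as initial segments are countable.
  have hcard : #((ℕ × StageTask I) × I) = #I := by
    have h1 : (ℵ_ 1 : Cardinal.{0}) ^ ℵ₀ = ℵ_ 1 := by rw [← CH, Cardinal.continuum_power_aleph0]
    have h2 : (ℵ₀ : Cardinal.{0}) ≤ ℵ_ 1 := Cardinal.aleph0_le_aleph 1
    have h3 : (ℵ_ 1 : Cardinal.{0}) * ℵ_ 1 = ℵ_ 1 := Cardinal.mul_eq_self h2
    have h5 : (5 : Cardinal.{0}) * ℵ_ 1 = ℵ_ 1 :=
      Cardinal.mul_eq_right h2 ((Cardinal.natCast_lt_aleph0 (n := 5)).le.trans h2) (by norm_num)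
    simp only [StageTask, Cardinal.mk_prod, Cardinal.lift_id, Cardinal.mk_fin,
      Cardinal.mk_finset_of_infinite, Cardinal.mk_arrow, hI, Cardinal.mk_nat, h1, h3]
    rw [show ((5 : ℕ) : Cardinal.{0}) = 5 from rfl, h5, Cardinal.aleph0_mul_eq h2, h3]
  obtain ⟨e⟩ := Cardinal.eq.1 hcard
  refine ⟨I, inferInstance, inferInstance, hI, hc, ?_, fun α => (e.symm α).1.1,
    fun α => (e.symm α).1.2, ?_⟩
  · intro D hD
    by_contra! h
    refine hunc ((hD.biUnion fun ξ _ => hc' ξ).mono fun a _ => ?_)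
    obtain ⟨ξ, hξ, h⟩ := h a
    exact Set.mem_biUnion hξ h
  · intro n t a
    by_contra! h
    refine hunc (Set.Countable.mono (s₂ := (fun ξ => (e.symm ξ).2) '' Set.Iic a) ?_
      ((hc' a).image _))
    intro ξ _
    refine ⟨e ((n, t), ξ), ?_, by simp⟩
    by_contra hlt
    exact h _ (not_le.1 hlt) (by simp) (by simp)

/-! ### Neighbourhoods in 2^I and passage to regular closed subsets -/

theorem mem_nhds_pi_bool {I : Type*} {x : I → Bool} {U : Set (I → Bool)} :
    U ∈ 𝓝 x ↔ ∃ F : Finset I, ∀ x' : I → Bool, (∀ β ∈ F, x' β = x β) → x' ∈ U := by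
  classical
  constructor
  · intro h
    rw [nhds_pi, Filter.mem_pi] at h
    obtain ⟨F, hF, t, ht, hU⟩ := h
    refine ⟨hF.toFinset, fun x' hx' => hU fun β hβ => ?_⟩
    rw [hx' β (hF.mem_toFinset.2 hβ)]
    exact mem_of_mem_nhds (ht β)
  · rintro ⟨F, hF⟩
    refine mem_of_superset (set_pi_mem_nhds F.finite_toSet (s := fun β => {x β})
      fun β _ => by simp) fun x' hx' => hF x' fun β hβ => hx' β hβ

section RegularClosed

variable {Y : Type u} [TopologicalSpace Y] {F : Set Y}

/-- A dense set meets the open set `interior F` densely, and the interior is dense in `F`. Since `F`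
is closed, limits stay inside, so the positive properties pass to regular closed sets. -/
theorem Dense.preimage_inter_interior (hF : closure (interior F) = F) {D : Set Y} (hD : Dense D) :
    Dense ((↑) ⁻¹' (D ∩ interior F) : Set F) := by
  intro x
  rw [closure_subtype, Subtype.image_preimage_coe, ← Set.inter_assoc, Set.inter_right_comm,
    Set.inter_eq_right.2 interior_subset]
  exact closure_minimal (hD.open_subset_closure_inter isOpen_interior) isClosed_closure
    (hF.symm ▸ x.2 : (x : Y) ∈ closure (interior F))

theorem HasConvergentSubseq.of_coe (hF : IsClosed F) {a : ℕ → F}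
    (h : HasConvergentSubseq fun n => (a n : Y)) : HasConvergentSubseq a := by
  obtain ⟨x, φ, hφ, hx⟩ := h
  exact ⟨⟨x, hF.mem_of_tendsto hx (Eventually.of_forall fun n => (a (φ n)).2)⟩, φ, hφ,
    tendsto_subtype_rng.2 hx⟩

theorem acc_nonempty_of_coe (hF : IsClosed F) {a : ℕ → F}
    (h : (acc fun n => (a n : Y)).Nonempty) : (acc a).Nonempty := by
  obtain ⟨x, hx⟩ := h
  have hxF : x ∈ F := by
    by_contra hxF
    obtain ⟨n, hn⟩ := (hx Fᶜ hF.isOpen_compl hxF).nonempty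
    exact hn (a n).2
  refine ⟨⟨x, hxF⟩, fun U hU hxU => ?_⟩
  obtain ⟨V, hV, rfl⟩ := isOpen_induced_iff.1 hU
  exact hx V hV hxU

theorem DRSOmega.regularClosed (h : DRSOmega Y) (hF : closure (interior F) = F) :
    DRSOmega F := by
  obtain ⟨D, hD, hd⟩ := h
  exact ⟨fun n => (↑) ⁻¹' (D n ∩ interior F), fun n => (hD n).preimage_inter_interior hF,
    fun d hdD => .of_coe (hF ▸ isClosed_closure) (hd _ fun n => (hdD n).1)⟩

theorem DRCOmega.regularClosed (h : DRCOmega Y) (hF : closure (interior F) = F) :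
    DRCOmega F := by
  obtain ⟨D, hD, hd⟩ := h
  exact ⟨fun n => (↑) ⁻¹' (D n ∩ interior F), fun n => (hD n).preimage_inter_interior hF,
    fun d hdD => acc_nonempty_of_coe (hF ▸ isClosed_closure) (hd _ fun n => (hdD n).1)⟩

theorem DRC.regularClosed (h : DRC Y) (hF : closure (interior F) = F) : DRC F := by
  obtain ⟨D, hD, hd⟩ := h
  exact ⟨(↑) ⁻¹' (D ∩ interior F), hD.preimage_inter_interior hF,
    fun d hdD => acc_nonempty_of_coe (hF ▸ isClosed_closure) (hd _ fun n => (hdD n).1)⟩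

end RegularClosed

/-! ### From the matrix to properties of the space of rows -/

section Realization

variable {I : Type u} {z : I → I → Bool} {Y : Type u} [TopologicalSpace Y] {j : Y → I → Bool}
  {y : I → Y} {lev : I → ℕ}

theorem Topology.IsInducing.mem_nhds_pi_bool (hj : IsInducing j) (x : Y) {U : Set Y} :
    U ∈ 𝓝 x ↔ ∃ F : Finset I, ∀ x' : Y, (∀ β ∈ F, j x' β = j x β) → x' ∈ U := by
  rw [hj.nhds_eq_comap, mem_comap]
  constructor
  · rintro ⟨t, ht, hU⟩
    obtain ⟨F, hF⟩ := _root_.mem_nhds_pi_bool.1 ht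
    exact ⟨F, fun x' hx' => hU (hF _ hx')⟩
  · rintro ⟨F, hF⟩
    exact ⟨{x' | ∀ β ∈ F, x' β = j x β}, _root_.mem_nhds_pi_bool.2 ⟨F, fun x' hx' => hx'⟩, hF⟩

theorem dense_of_forall_finset (hj : IsInducing j) {D : Set Y}
    (h : ∀ (F : Finset I) (x : I → Bool), ∃ d ∈ D, ∀ β ∈ F, j d β = x β) : Dense D := by
  intro x
  refine mem_closure_iff_nhds.2 fun U hU => ?_
  obtain ⟨F, hF⟩ := (hj.mem_nhds_pi_bool x).1 hU
  obtain ⟨d, hd, h⟩ := h F (j x)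
  exact ⟨d, hF d h, hd⟩

theorem Topology.IsInducing.isOpen_eval_eq (hj : IsInducing j) (β : I) (v : Bool) :
    IsOpen {x | j x β = v} :=
  (isOpen_discrete {v}).preimage ((continuous_apply β).comp hj.continuous)

/-- Dense sets with points of arbitrarily high level. -/
theorem dense_levels (hj : IsInducing j) (hy : ∀ ξ, j (y ξ) = z ξ)
    (hdense : ∀ n (F : Finset I) (x : I → Bool), ∃ ξ, lev ξ = n ∧ ∀ β ∈ F, z ξ β = x β) (n : ℕ) :
    Dense (y '' {ξ | n ≤ lev ξ}) :=
  dense_of_forall_finset hj fun F x => by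
    obtain ⟨ξ, rfl, h⟩ := hdense n F x
    exact ⟨y ξ, ⟨ξ, le_refl (lev ξ), rfl⟩, by simpa [hy] using h⟩

/-- The sets on which the level is constant. -/
def ConstLevel (lev : I → ℕ) (A : Set I) : Prop := ∃ n, ∀ η ∈ A, lev η = n

/-- The sets on which the level is finite-to-one. -/
def DivLevel (lev : I → ℕ) (A : Set I) : Prop := ∀ n, {η ∈ A | lev η = n}.Finite

theorem ConstLevel.mono {A B : Set I} (h : A ⊆ B) (hB : ConstLevel lev B) : ConstLevel lev A :=
  hB.imp fun _ hn η hη => hn η (h hη)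

theorem DivLevel.mono {A B : Set I} (h : A ⊆ B) (hB : DivLevel lev B) : DivLevel lev A :=
  fun n => (hB n).subset fun _ hη => ⟨h hη.1, hη.2⟩

theorem DivLevel.inter_constLevel {A B : Set I} (hA : DivLevel lev A) (hB : ConstLevel lev B) :
    (A ∩ B).Finite := by
  obtain ⟨n, hn⟩ := hB
  exact (hA n).subset fun η hη => ⟨hη.1, hn η hη.2⟩

theorem finite_preimage_of_le_lev {a : ℕ → I} (ha : ∀ n, n ≤ lev (a n)) {S : Set I}
    (hS : S.Finite) : (a ⁻¹' S).Finite := by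
  obtain ⟨m, hm⟩ := (hS.image lev).bddAbove
  exact (Set.finite_Iic m).subset fun n hn => (ha n).trans (hm ⟨_, hn, rfl⟩)

theorem infinite_range_of_le_lev {a : ℕ → I} (ha : ∀ n, n ≤ lev (a n)) :
    (Set.range a).Infinite := fun h =>
  Set.infinite_univ ((finite_preimage_of_le_lev ha h).subset fun n _ => ⟨n, rfl⟩)

theorem divLevel_range {a : ℕ → I} (ha : ∀ n, n ≤ lev (a n)) : DivLevel lev (Set.range a) := by
  intro n
  refine ((Set.finite_Iic n).image a).subset ?_
  rintro _ ⟨⟨m, rfl⟩, hm⟩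
  exact ⟨m, hm ▸ ha m, rfl⟩

/-- A choice from the sets of level at least `n` is finite-to-one in its indices, so convergence
modulo finite sets of indices becomes convergence of a subsequence. -/
theorem drsOmega_of_divLevel (hj : IsInducing j) (hy : ∀ ξ, j (y ξ) = z ξ)
    (hdense : ∀ n (F : Finset I) (x : I → Bool), ∃ ξ, lev ξ = n ∧ ∀ β ∈ F, z ξ β = x β)
    (hconv : ∀ A : Set I, A.Countable → A.Infinite → DivLevel lev A →
        ∃ ξ, ∃ B ⊆ A, B.Infinite ∧ ∀ β, {η ∈ B | z η β ≠ z ξ β}.Finite) : DRSOmega Y := by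
  refine ⟨_, dense_levels hj hy hdense, fun d hd => ?_⟩
  choose a ha hda' using hd
  have hda : ∀ n, d n = y (a n) := fun n => (hda' n).symm
  obtain ⟨ξ, B, hBA, hB, hlim⟩ := hconv _ (Set.countable_range a) (infinite_range_of_le_lev ha)
    (divLevel_range ha)
  have hBinf : {n | a n ∈ B}.Infinite := fun h => hB ((h.image a).subset fun η hη => by
    obtain ⟨n, rfl⟩ := hBA hη
    exact ⟨n, hη, rfl⟩)
  have hmem : ∀ k, a (Nat.nth (fun n => a n ∈ B) k) ∈ B := Nat.nth_mem_of_infinite hBinf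
  have hmono := Nat.nth_strictMono hBinf
  refine ⟨y ξ, _, hmono, fun U hU => mem_map.2 ?_⟩
  obtain ⟨F, hF⟩ := (hj.mem_nhds_pi_bool _).1 hU
  have hfin : (a ⁻¹' ⋃ β ∈ F, {η ∈ B | z η β ≠ z ξ β}).Finite :=
    finite_preimage_of_le_lev ha (F.finite_toSet.biUnion fun β _ => hlim β)
  have h := hmono.injective.tendsto_cofinite.eventually hfin.compl_mem_cofinite
  rw [Nat.cofinite_eq_atTop] at h
  filter_upwards [h] with k hk
  refine hF _ fun β hβ => ?_
  by_contra hne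
  simp only [Function.comp_apply, hda, hy] at hne
  exact hk (Set.mem_biUnion (x := β) hβ ⟨hmem k, hne⟩)

theorem mem_acc_of_forall_finset (hj : IsInducing j) (hy : ∀ ξ, j (y ξ) = z ξ) {a : ℕ → I} {ξ : I}
    (h : ∀ F : Finset I, {η ∈ Set.range a | ∀ β ∈ F, z η β = z ξ β}.Infinite) :
    y ξ ∈ acc fun n => y (a n) := by
  intro U hU hξ hfin
  obtain ⟨F, hF⟩ := (hj.mem_nhds_pi_bool _).1 (hU.mem_nhds hξ)
  refine h F ((hfin.image a).subset ?_)
  rintro _ ⟨⟨n, rfl⟩, hn⟩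
  exact ⟨n, hF _ fun β hβ => by rw [hy, hy]; exact hn β hβ, rfl⟩

theorem drcOmega_of_divLevel (hj : IsInducing j) (hy : ∀ ξ, j (y ξ) = z ξ)
    (hdense : ∀ n (F : Finset I) (x : I → Bool), ∃ ξ, lev ξ = n ∧ ∀ β ∈ F, z ξ β = x β)
    (hacc : ∀ A : Set I, A.Countable → A.Infinite → DivLevel lev A →
        ∃ ξ, ∀ F : Finset I, {η ∈ A | ∀ β ∈ F, z η β = z ξ β}.Infinite) : DRCOmega Y := by
  refine ⟨_, dense_levels hj hy hdense, fun d hd => ?_⟩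
  choose a ha hda' using hd
  have hda : ∀ n, d n = y (a n) := fun n => (hda' n).symm
  obtain ⟨ξ, hξ⟩ := hacc _ (Set.countable_range a) (infinite_range_of_le_lev ha)
    (divLevel_range ha)
  rw [show d = fun n => y (a n) from funext hda]
  exact ⟨y ξ, mem_acc_of_forall_finset hj hy hξ⟩

theorem drc_of_constLevel (hj : IsInducing j) (hy : ∀ ξ, j (y ξ) = z ξ)
    (hdense : ∀ n (F : Finset I) (x : I → Bool), ∃ ξ, lev ξ = n ∧ ∀ β ∈ F, z ξ β = x β)
    (hacc : ∀ A : Set I, A.Countable → A.Infinite → ConstLevel lev A →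
        ∃ ξ, ∀ F : Finset I, {η ∈ A | ∀ β ∈ F, z η β = z ξ β}.Infinite) : DRC Y := by
  refine ⟨y '' {ξ | lev ξ = 0}, dense_of_forall_finset hj fun F x => ?_, fun d hd => ?_⟩
  · obtain ⟨ξ, h0, h⟩ := hdense 0 F x
    exact ⟨y ξ, ⟨ξ, h0, rfl⟩, by simpa [hy] using h⟩
  choose a ha hda using hd
  rw [show d = fun n => y (a n) from funext fun n => (hda n).symm]
  by_cases hinf : (Set.range a).Infinite
  · obtain ⟨ξ, hξ⟩ := hacc _ (Set.countable_range a) hinf ⟨0, by rintro _ ⟨n, rfl⟩; exact ha n⟩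
    exact ⟨y ξ, mem_acc_of_forall_finset hj hy hξ⟩
  -- If only finitely many indices occur, one of them occurs infinitely often and gives the
  -- accumulation point.
  · have : Finite (Set.range a) := Set.not_infinite.1 hinf
    obtain ⟨⟨_, m, rfl⟩, hm⟩ := Finite.exists_infinite_fiber (Set.rangeFactorization a)
    refine ⟨y (a m), fun U hU hmU => (Set.infinite_coe_iff.1 hm).mono fun n hn => ?_⟩
    have : a n = a m := congrArg Subtype.val hn
    simpa [this] using hmU

variable {F : Set Y}

/-- The dense subsets of a regular closed set are uncountable. -/
theorem not_countable_of_dense (hj : IsInducing j) (hy : ∀ ξ, j (y ξ) = z ξ)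
    (hsurj : Function.Surjective y)
    (hdense : ∀ n (F : Finset I) (x : I → Bool), ∃ ξ, lev ξ = n ∧ ∀ β ∈ F, z ξ β = x β)
    (hzero : ∀ D : Set I, D.Countable → ∀ F : Finset I, ∃ β, β ∉ F ∧ ∀ ξ ∈ D, z ξ β = false)
    (hne : F.Nonempty) (hF : closure (interior F) = F) {D : Set F} (hD : Dense D) :
    ¬ {ξ | ∃ x ∈ D, (x : Y) = y ξ}.Countable := by
  classical
  intro hcount
  have hint : (interior F).Nonempty := by
    rw [← hF] at hne
    exact closure_nonempty_iff.1 hne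
  obtain ⟨x, hx⟩ := hint
  obtain ⟨E, hE⟩ := (hj.mem_nhds_pi_bool x).1 (isOpen_interior.mem_nhds hx)
  -- All of `D` vanishes at `β`, while `β` is free in the basic open set with support `E` inside
  -- `F`. So the value 1 at `β` defines a nonempty open part of the interior that misses `D`.
  obtain ⟨β, hβ, hβ0⟩ := hzero _ hcount E
  obtain ⟨ξ, -, hξ⟩ := hdense 0 (insert β E) fun γ => if γ = β then true else j x γ
  have hξβ : j (y ξ) β = true := by simpa [hy] using hξ β (by simp)
  have hξF : y ξ ∈ interior F := hE _ fun γ hγ => by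
    rw [hy, hξ γ (by simp [hγ]), if_neg (by rintro rfl; exact hβ hγ)]
  obtain ⟨d, ⟨hd1, -⟩, hd2⟩ := mem_closure_iff.1 (hD ⟨y ξ, interior_subset hξF⟩)
    ((↑) ⁻¹' ({x | j x β = true} ∩ interior F))
    (((hj.isOpen_eval_eq β true).inter isOpen_interior).preimage continuous_subtype_val)
    ⟨hξβ, hξF⟩
  obtain ⟨η, hη⟩ := hsurj d
  have := hβ0 η ⟨d, hd2, hη.symm⟩
  rw [← hy, hη] at this
  exact absurd (hd1.symm.trans this) (by simp)

/-- Uncountably many indices are spread over countably many levels, so some level contains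
infinitely many. -/
theorem exists_injective_of_dense (hj : IsInducing j) (hy : ∀ ξ, j (y ξ) = z ξ)
    (hsurj : Function.Surjective y)
    (hdense : ∀ n (F : Finset I) (x : I → Bool), ∃ ξ, lev ξ = n ∧ ∀ β ∈ F, z ξ β = x β)
    (hzero : ∀ D : Set I, D.Countable → ∀ F : Finset I, ∃ β, β ∉ F ∧ ∀ ξ ∈ D, z ξ β = false)
    (hne : F.Nonempty) (hF : closure (interior F) = F) {D : Set F} (hD : Dense D) :
    ∃ (a : ℕ → I) (d : ℕ → F), Function.Injective a ∧ ConstLevel lev (Set.range a) ∧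
      ∀ n, d n ∈ D ∧ (d n : Y) = y (a n) := by
  have hunc := not_countable_of_dense hj hy hsurj hdense hzero hne hF hD
  obtain ⟨m, hm⟩ : ∃ m, {ξ ∈ {ξ | ∃ x ∈ D, (x : Y) = y ξ} | lev ξ = m}.Infinite := by
    by_contra! h
    refine hunc ((Set.countable_iUnion fun m => (h m).countable).mono fun ξ hξ => ?_)
    exact Set.mem_iUnion.2 ⟨lev ξ, hξ, rfl⟩
  let a := hm.natEmbedding
  choose d hd using fun n => (a n).2.1
  exact ⟨fun n => a n, d, Subtype.val_injective.comp a.injective,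
    ⟨m, by rintro _ ⟨n, rfl⟩; exact (a n).2.2⟩, hd⟩

theorem finite_ne_of_tendsto (hj : IsInducing j) (hy : ∀ ξ, j (y ξ) = z ξ) {b : ℕ → I}
    {d : ℕ → F} (hd : ∀ n, (d n : Y) = y (b n)) {x : F} (hx : Tendsto d atTop (𝓝 x)) (β : I) :
    {η ∈ Set.range b | z η β ≠ j x β}.Finite := by
  have h := (continuous_subtype_val.tendsto x).comp hx
    |>.eventually_mem ((hj.isOpen_eval_eq β (j x β)).mem_nhds rfl)
  obtain ⟨m, hm⟩ := eventually_atTop.1 h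
  refine ((Set.finite_Iio m).image b).subset ?_
  rintro _ ⟨⟨n, rfl⟩, hn⟩
  refine ⟨n, ?_, rfl⟩
  by_contra hlt
  have := hm n (not_lt.1 hlt)
  simp only [Function.comp_apply, hd, Set.mem_ofPred_eq, hy] at this
  exact hn this

theorem not_tendsto_of_split (hj : IsInducing j) (hy : ∀ ξ, j (y ξ) = z ξ) {b : ℕ → I}
    {d : ℕ → F} (hd : ∀ n, (d n : Y) = y (b n)) {x : F}
    (hsplit : ∃ β, ∀ v, {η ∈ Set.range b | z η β = v}.Infinite) :
    ¬ Tendsto d atTop (𝓝 x) := by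
  intro hx
  obtain ⟨β, hβ⟩ := hsplit
  refine hβ (!(j x β)) ((finite_ne_of_tendsto hj hy hd hx β).subset fun η hη => ⟨hη.1, ?_⟩)
  rw [hη.2]
  simp

theorem not_drs_of_constLevel (hj : IsInducing j) (hy : ∀ ξ, j (y ξ) = z ξ)
    (hsurj : Function.Surjective y)
    (hdense : ∀ n (F : Finset I) (x : I → Bool), ∃ ξ, lev ξ = n ∧ ∀ β ∈ F, z ξ β = x β)
    (hzero : ∀ D : Set I, D.Countable → ∀ F : Finset I, ∃ β, β ∉ F ∧ ∀ ξ ∈ D, z ξ β = false)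
    (hsplit : ∀ A : Set I, A.Countable → A.Infinite → ConstLevel lev A →
        ∃ β, ∀ v, {η ∈ A | z η β = v}.Infinite)
    (hne : F.Nonempty) (hF : closure (interior F) = F) : ¬ DRS F := by
  rintro ⟨D, hD, h⟩
  obtain ⟨a, d, ha, hc, hd⟩ := exists_injective_of_dense hj hy hsurj hdense hzero hne hF hD
  obtain ⟨x, φ, hφ, hx⟩ := h d fun n => (hd n).1
  exact not_tendsto_of_split hj hy (b := a ∘ φ) (fun n => (hd (φ n)).2)
    (hsplit _ (Set.countable_range _) (Set.infinite_range_of_injective (ha.comp hφ.injective))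
      (hc.mono (Set.range_comp_subset_range φ a))) hx

/-- For any candidate `y e`, an isolating coordinate gives a neighbourhood containing at most one
term of an injectively indexed sequence of constant level. -/
theorem not_drc_of_constLevel (hj : IsInducing j) (hy : ∀ ξ, j (y ξ) = z ξ)
    (hsurj : Function.Surjective y)
    (hdense : ∀ n (F : Finset I) (x : I → Bool), ∃ ξ, lev ξ = n ∧ ∀ β ∈ F, z ξ β = x β)
    (hzero : ∀ D : Set I, D.Countable → ∀ F : Finset I, ∃ β, β ∉ F ∧ ∀ ξ ∈ D, z ξ β = false)
    (hdisc : ∀ A : Set I, A.Countable → A.Infinite → ConstLevel lev A → ∀ e,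
        ∃ β, z e β = true ∧ ∀ η ∈ A, η ≠ e → z η β = false)
    (hne : F.Nonempty) (hF : closure (interior F) = F) : ¬ DRC F := by
  rintro ⟨D, hD, h⟩
  obtain ⟨a, d, ha, hc, hd⟩ := exists_injective_of_dense hj hy hsurj hdense hzero hne hF hD
  obtain ⟨x, hx⟩ := h d fun n => (hd n).1
  obtain ⟨e, he⟩ := hsurj x
  obtain ⟨β, hβ, hβ'⟩ := hdisc _ (Set.countable_range _) (Set.infinite_range_of_injective ha) hc e
  refine hx ((↑) ⁻¹' {x | j x β = true})
    ((hj.isOpen_eval_eq β true).preimage continuous_subtype_val)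
    (by simpa [← he, hy] using hβ) (((Set.finite_singleton e).preimage ha.injOn).subset ?_)
  intro n hn
  by_contra hne
  have hn' : j (d n) β = true := hn
  rw [(hd n).2, hy, hβ' _ ⟨n, rfl⟩ hne] at hn'
  exact absurd hn' (by simp)

/-- A convergent subsequence with injective indices either has finite-to-one level, where a
splitting coordinate prevents convergence, or is infinite on one level, where an isolating
coordinate separates that part from the limit. -/
theorem not_drsOmega_of_levels (hj : IsInducing j) (hy : ∀ ξ, j (y ξ) = z ξ)
    (hsurj : Function.Surjective y)
    (hdense : ∀ n (F : Finset I) (x : I → Bool), ∃ ξ, lev ξ = n ∧ ∀ β ∈ F, z ξ β = x β)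
    (hzero : ∀ D : Set I, D.Countable → ∀ F : Finset I, ∃ β, β ∉ F ∧ ∀ ξ ∈ D, z ξ β = false)
    (hsplit : ∀ A : Set I, A.Countable → A.Infinite → DivLevel lev A →
        ∃ β, ∀ v, {η ∈ A | z η β = v}.Infinite)
    (hdisc : ∀ A : Set I, A.Countable → A.Infinite → ConstLevel lev A → ∀ e,
        ∃ β, z e β = true ∧ ∀ η ∈ A, η ≠ e → z η β = false)
    (hne : F.Nonempty) (hF : closure (interior F) = F) : ¬ DRSOmega F := by
  rintro ⟨D, hD, h⟩
  obtain ⟨a, ha, had⟩ := exists_injective_forall_mem (fun n => {ξ | ∃ x ∈ D n, (x : Y) = y ξ})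
    fun n hfin => not_countable_of_dense hj hy hsurj hdense hzero hne hF (hD n) hfin.countable
  choose d hdD hd using had
  obtain ⟨x, φ, hφ, hx⟩ := h d hdD
  have hinj := ha.comp hφ.injective
  by_cases hdiv : DivLevel lev (Set.range (a ∘ φ))
  · exact not_tendsto_of_split hj hy (b := a ∘ φ) (fun n => hd (φ n))
      (hsplit _ (Set.countable_range _) (Set.infinite_range_of_injective hinj) hdiv) hx
  · simp only [DivLevel, not_forall] at hdiv
    obtain ⟨m, hm⟩ := hdiv
    obtain ⟨e, he⟩ := hsurj x
    obtain ⟨β, hβ, hβ'⟩ := hdisc {η ∈ Set.range (a ∘ φ) | lev η = m}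
      ((Set.countable_range _).mono fun η hη => hη.1) hm ⟨m, fun η hη => hη.2⟩ e
    refine hm (((finite_ne_of_tendsto hj hy (b := a ∘ φ) (fun n => hd (φ n)) hx β).union
      (Set.finite_singleton e)).subset fun η hη => ?_)
    by_cases hηe : η = e
    · exact Or.inr hηe
    · refine Or.inl ⟨hη.1, ?_⟩
      rw [← he, hy, hβ, hβ' η hη hηe]
      simp

end Realization

/-! ### The common space and the three dense subspaces -/

section

variable {I : Type u} {T : Set (I → Bool)}

theorem isZeroDimensional_of_isInducing {Y : Type u} [TopologicalSpace Y] {j : Y → I → Bool}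
    (hj : IsInducing j) : IsZeroDimensional Y := by
  refine TopologicalSpace.isTopologicalBasis_of_isOpen_of_nhds (fun U hU => hU.isOpen) ?_
  intro x U hx hU
  obtain ⟨F, hF⟩ := (hj.mem_nhds_pi_bool x).1 (hU.mem_nhds hx)
  refine ⟨⋂ β ∈ F, {x' | j x' β = j x β}, ?_, ?_, ?_⟩
  · exact F.finite_toSet.isClopen_biInter fun β _ =>
      (isClopen_discrete {j x β}).preimage ((continuous_apply β).comp hj.continuous)
  · simp
  · exact fun x' hx' => hF x' fun β hβ => Set.mem_iInter₂.1 hx' β hβ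

/-- The set of points of a subspace of `2^I` that are rows of a matrix. -/
def rowSet (T : Set (I → Bool)) (z : I → I → Bool) : Set T := {x | (x : I → Bool) ∈ Set.range z}

variable {z : I → I → Bool}

/-- The rows of a matrix as points of the subspace they form. -/
def rowPoint (hz : ∀ ξ, z ξ ∈ T) (ξ : I) : rowSet T z := ⟨⟨z ξ, hz ξ⟩, ξ, rfl⟩

theorem rowPoint_surjective (hz : ∀ ξ, z ξ ∈ T) : Function.Surjective (rowPoint hz) := by
  rintro ⟨⟨x, h⟩, ξ, hξ⟩
  exact ⟨ξ, Subtype.ext (Subtype.ext hξ)⟩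

theorem isInducing_rowSet : IsInducing fun x : rowSet T z => ((x : T) : I → Bool) :=
  IsInducing.subtypeVal.comp IsInducing.subtypeVal

theorem dense_rowSet (hz : ∀ ξ, z ξ ∈ T)
    (h : ∀ (F : Finset I) (x : I → Bool), ∃ ξ, ∀ β ∈ F, z ξ β = x β) :
    Dense (rowSet T z) :=
  dense_of_forall_finset IsInducing.subtypeVal fun F x => by
    obtain ⟨ξ, hξ⟩ := h F x
    exact ⟨⟨z ξ, hz ξ⟩, ⟨ξ, rfl⟩, hξ⟩

end

open Cardinal in
theorem theorem1p3 (CH : Cardinal.continuum.{0} = Cardinal.aleph.{0} 1) :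
    ∃ (X : Type) (_ : TopologicalSpace X),
      PerfectSpace X ∧ IsZeroDimensional X ∧ T2Space X ∧
      Cardinal.mk X = Cardinal.aleph.{0} 1 ∧
      ∃ Z₁ Z₂ Z₃ : Set X, Dense Z₁ ∧ Dense Z₂ ∧ Dense Z₃ ∧
        Hereditarily (fun Y _ => DRSOmega Y ∧ ¬ DRC Y) Z₁ ∧
        Hereditarily (fun Y _ => DRSOmega Y ∧ DRC Y ∧ ¬ DRS Y) Z₂ ∧
        Hereditarily (fun Y _ => DRCOmega Y ∧ ¬ DRC Y ∧ ¬ DRSOmega Y) Z₃ := by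
  classical
  obtain ⟨I, _, _, hI, hc, hbdd, lev, task, htask⟩ := exists_bookkeeping CH
  -- A predicate that is constantly `False` switches off the corresponding requirement.
  obtain ⟨z₁, dense₁, zero₁, conv₁, -, -, disc₁⟩ := exists_matrix (Conv := DivLevel lev)
    (Split := fun _ => False) (Disc := ConstLevel lev) hc hbdd (fun _ _ => .mono) (fun _ _ _ => id)
    (fun _ _ _ h => h.elim) (fun _ _ => DivLevel.inter_constLevel) (fun _ _ h => h.elim)
    lev task htask
  obtain ⟨z₂, dense₂, zero₂, conv₂, acc₂, split₂, -⟩ := exists_matrix (Conv := DivLevel lev)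
    (Split := ConstLevel lev) (Disc := fun _ => False) hc hbdd (fun _ _ => .mono) (fun _ _ => .mono)
    (fun _ _ => DivLevel.inter_constLevel) (fun _ _ _ h => h.elim) (fun _ _ _ h => h.elim)
    lev task htask
  obtain ⟨z₃, dense₃, zero₃, -, acc₃, split₃, disc₃⟩ := exists_matrix (Conv := fun _ => False)
    (Split := DivLevel lev) (Disc := ConstLevel lev) hc hbdd (fun _ _ _ => id) (fun _ _ => .mono)
    (fun _ _ h => h.elim) (fun _ _ h => h.elim) (fun _ _ => DivLevel.inter_constLevel)
    lev task htask
  let T : Set (I → Bool) := Set.range z₁ ∪ Set.range z₂ ∪ Set.range z₃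
  have h₁ : ∀ ξ, z₁ ξ ∈ T := fun ξ => Or.inl (Or.inl ⟨ξ, rfl⟩)
  have h₂ : ∀ ξ, z₂ ξ ∈ T := fun ξ => Or.inl (Or.inr ⟨ξ, rfl⟩)
  have h₃ : ∀ ξ, z₃ ξ ∈ T := fun ξ => Or.inr ⟨ξ, rfl⟩
  have hT : IsInducing ((↑) : T → I → Bool) := IsInducing.subtypeVal
  refine ⟨T, inferInstance, ⟨?_⟩, isZeroDimensional_of_isInducing hT, inferInstance, ?_,
    rowSet T z₁, rowSet T z₂, rowSet T z₃,
    dense_rowSet h₁ fun F x => (dense₁ 0 F x).imp fun _ => And.right,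
    dense_rowSet h₂ fun F x => (dense₂ 0 F x).imp fun _ => And.right,
    dense_rowSet h₃ fun F x => (dense₃ 0 F x).imp fun _ => And.right, ?_, ?_, ?_⟩
  · intro x _
    rw [accPt_iff_nhds]
    intro U hU
    obtain ⟨F, hF⟩ := (hT.mem_nhds_pi_bool x).1 hU
    -- This serves only to find a coordinate outside `F`; flipping `x` there gives a different point
    -- nearby.
    obtain ⟨β, hβ, -⟩ := zero₁ ∅ Set.countable_empty F
    obtain ⟨ξ, -, hξ⟩ := dense₁ 0 (insert β F) fun γ => if γ = β then !(x : I → Bool) β else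
      (x : I → Bool) γ
    refine ⟨⟨z₁ ξ, h₁ ξ⟩, ⟨hF _ fun γ hγ => ?_, trivial⟩, ?_⟩
    · exact (hξ γ (by simp [hγ])).trans (if_neg (by rintro rfl; exact hβ hγ))
    · rintro rfl
      simpa using hξ β (by simp)
  · refine le_antisymm ?_ ?_
    · have hr : ∀ z : I → I → Bool, #(Set.range z) ≤ ℵ_ 1 := fun z => hI ▸ Cardinal.mk_range_le
      have hinf : (ℵ₀ : Cardinal.{0}) ≤ ℵ_ 1 := Cardinal.aleph0_le_aleph 1
      exact (Cardinal.mk_union_le _ _).trans (Cardinal.add_le_of_le hinf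
        ((Cardinal.mk_union_le _ _).trans (Cardinal.add_le_of_le hinf (hr _) (hr _))) (hr _))
    · rw [← Cardinal.succ_aleph0, Order.succ_le_iff]
      by_contra! h
      have hcount : (Set.range z₁).Countable :=
        (Cardinal.le_aleph0_iff_set_countable.1 h).mono fun x hx => Or.inl (Or.inl hx)
      have := hcount.to_subtype
      -- One index per row suffices: if the rows were countably many, all would vanish at a common
      -- coordinate, against density.
      choose k hk using fun x : Set.range z₁ => x.2
      obtain ⟨β, -, hβ⟩ := zero₁ _ (Set.countable_range k) ∅
      obtain ⟨ξ, -, hξ⟩ := dense₁ 0 {β} fun _ => true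
      have h0 : z₁ (k ⟨z₁ ξ, Set.mem_range_self ξ⟩) β = false := hβ _ (Set.mem_range_self _)
      have h1 : z₁ ξ β = true := hξ β (by simp)
      rw [hk] at h0
      exact absurd (h1.symm.trans h0) (by simp)
  · intro F hne hF
    exact ⟨(drsOmega_of_divLevel isInducing_rowSet (y := rowPoint h₁) (fun _ => rfl) dense₁ conv₁).regularClosed
        hF,
      not_drc_of_constLevel isInducing_rowSet (fun _ => rfl) (rowPoint_surjective h₁) dense₁ zero₁
        disc₁ hne hF⟩
  · intro F hne hF
    exact ⟨(drsOmega_of_divLevel isInducing_rowSet (y := rowPoint h₂) (fun _ => rfl) dense₂ conv₂).regularClosed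
        hF,
      (drc_of_constLevel isInducing_rowSet (y := rowPoint h₂) (fun _ => rfl) dense₂ acc₂).regularClosed
        hF,
      not_drs_of_constLevel isInducing_rowSet (fun _ => rfl) (rowPoint_surjective h₂) dense₂ zero₂
        split₂ hne hF⟩
  · intro F hne hF
    exact ⟨(drcOmega_of_divLevel isInducing_rowSet (y := rowPoint h₃) (fun _ => rfl) dense₃ acc₃).regularClosed
        hF,
      not_drc_of_constLevel isInducing_rowSet (fun _ => rfl) (rowPoint_surjective h₃) dense₃ zero₃
        disc₃ hne hF,
      not_drsOmega_of_levels isInducing_rowSet (fun _ => rfl) (rowPoint_surjective h₃) dense₃ zero₃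
        split₃ disc₃ hne hF⟩
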